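/- Let $(X,d)$ be a metric space and write $d[X^2]=\{d(x,y):x,y\in X\}$ and $S(c;D)=\{y\in X: d(c,y)\in D\}$ for $c\in X$, $D\subseteq\mathbb R$; write $S(c;r)=S(c;\{r\})$ and $\mathbb Q r=\{qr:q\in\mathbb Q\}$ for $r\in\mathbb R$. Call $X$ a Banakh space if for every $c\in X$ and every $r\in d[X^2]$ there are $u,v\in X$ with $S(c;r)=\{u,v\}$ and $d(u,v)=2r$. Isometries between metric spaces are understood to be surjective. A metric space $Y$ is centrally symmetric if for any distinct $c,y\in Y$ there is an isometry $f:Y\to Y$ with $f(c)=c$ and $f(y)\neq y$. A set $M\subseteq\mathbb R$ is a half-group if $M\cup(-M)$ is a subgroup of $(\mathbb R,+)$. Subsets of $\mathbb R$ and of $X$ carry the induced metric. Theorem. Let $X$ be a Banakh space. (a) For every point $x\in X$ and every $r\in d[X^2]$ the following conditions are equivalent: 1. the metric space $S(x;\mathbb Q r)$ is isometric to a subspace of $\mathbb R$; 2. the metric space $S(x;\mathbb Q r)$ is isometric to a subgroup of the additive group $\mathbb Q r$; 3. $d(y,z)\in\mathbb Q r$ for all $y,z\in S(x;\mathbb Q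 r)$; 4. the metric space $S(x;\mathbb Q r)$ is centrally symmetric; 5. $d[X^2]\cap\mathbb Q r$ is a half-group. (b) If $X$ is nonempty and $d[X^2]\subseteq\mathbb Q$, then $X$ is isometric to a subgroup of $\mathbb Q$. -/

import Mathlib

open scoped Pointwise

namespace BanakhSpace

/-- The distance set `d[X²]` of a metric space. -/
def distSet (X : Type*) [MetricSpace X] : Set ℝ :=
  {r | ∃ x y : X, dist x y = r}

/-- A Banakh space: every sphere `S(c; r)` with `r ∈ d[X²]` has the form `{x, y}`
with `d(x, y) = 2r`. -/
def IsBanakh (X : Type*) [MetricSpace X] : Prop :=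
  ∀ c : X, ∀ r ∈ distSet X, ∃ x y : X, Metric.sphere c r = {x, y} ∧ dist x y = 2 * r

/-- The `D`-sphere `S(x; D) = {y : d(x, y) ∈ D}`, for a set `D` of reals. -/
def setSphere {X : Type*} [MetricSpace X] (x : X) (D : Set ℝ) : Set X :=
  {y | dist x y ∈ D}

/-- The set `ℚr = {qr : q ∈ ℚ}` of real numbers. -/
def ratMultiples (r : ℝ) : Set ℝ :=
  {t | ∃ q : ℚ, t = (q : ℝ) * r}

/-- A metric space is centrally symmetric if for any distinct points `c, x` there is an
isometry of the space onto itself that fixes `c` and moves `x`. -/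
def IsCentrallySymmetric (X : Type*) [MetricSpace X] : Prop :=
  ∀ c x : X, c ≠ x → ∃ f : X ≃ᵢ X, f c = c ∧ f x ≠ x

/-- A set `M` of reals is a half-group if `M ∪ (-M)` is a subgroup of `ℝ`. -/
def IsHalfGroup (M : Set ℝ) : Prop :=
  ∃ H : AddSubgroup ℝ, (H : Set ℝ) = M ∪ (-M)

end BanakhSpace

namespace BanakhSpace

/-! ### Arithmetic of commensurable reals -/

section RatMultiples

/-! The two-point spheres give a point reflection at every point. Alternating reflections extend any
two distinct points to a scaled isometric copy of ℤ (`exists_line`). Hence every point is split into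
two sides: for commensurable distances from `x`, prolong both rays from `x` to a common radius `R`.
Since the sphere of radius `R` has two points, "same side" means "same far point". This yields a
signed distance `φ` from `x` on `S(x; ℚr)` (`exists_coord`). It is a bijection onto the reals whose
absolute value is a distance in ℚr, and it gives correct distances between opposite sides, so the
commensurable distances are closed under addition (`add_mem`).

Distances between points on one side are not controlled in general, and this is what the five
conditions decide. If such a distance is commensurable with `r`, it must be the difference of the
radii (`dist_eq_sub`), so (3) gives closure under subtraction, which is (5). Conversely, if
differences of radii are distances, two points on one side are that far apart, so `φ` is an isometry
onto the group (`exists_isometryEquiv`), giving (2). A subgroup of ℝ has point reflections, giving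
(4). From (4), |2s - t| is a distance whenever s and t are (`abs_two_mul_sub_mem`), and an
arithmetic progression run down from large terms reaches every difference s - t. Finally, (2) ⇒ (1)
⇒ (3) is clear.

When all distances are rational and some r > 0 occurs, `S(x; ℚr)` is the whole space and (3) is
automatic. -/

theorem ratMultiples_self (r : ℝ) : r ∈ ratMultiples r := ⟨1, by simp⟩

theorem ratMultiples_zero_mem (r : ℝ) : (0 : ℝ) ∈ ratMultiples r := ⟨0, by simp⟩

theorem ratMultiples_add {r a b : ℝ} (ha : a ∈ ratMultiples r) (hb : b ∈ ratMultiples r) :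
    a + b ∈ ratMultiples r := by
  obtain ⟨p, rfl⟩ := ha
  obtain ⟨q, rfl⟩ := hb
  exact ⟨p + q, by push_cast; ring⟩

theorem ratMultiples_neg {r a : ℝ} (ha : a ∈ ratMultiples r) : -a ∈ ratMultiples r := by
  obtain ⟨p, rfl⟩ := ha
  exact ⟨-p, by push_cast; ring⟩

theorem ratMultiples_sub {r a b : ℝ} (ha : a ∈ ratMultiples r) (hb : b ∈ ratMultiples r) :
    a - b ∈ ratMultiples r := by
  rw [sub_eq_add_neg]
  exact ratMultiples_add ha (ratMultiples_neg hb)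

theorem ratMultiples_abs_iff {r a : ℝ} : |a| ∈ ratMultiples r ↔ a ∈ ratMultiples r := by
  rcases abs_choice a with h | h
  · rw [h]
  · rw [h]
    exact ⟨fun h' => by simpa using ratMultiples_neg h', ratMultiples_neg⟩

/-- Two positive rational multiples of the same number have a common positive multiple. -/
theorem exists_nat_mul_eq {r a b : ℝ} (ha : a ∈ ratMultiples r) (hb : b ∈ ratMultiples r)
    (ha0 : 0 < a) (hb0 : 0 < b) :
    ∃ m n : ℕ, 0 < m ∧ 0 < n ∧ (m : ℝ) * a = n * b := by
  obtain ⟨p, rfl⟩ := ha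
  obtain ⟨q, rfl⟩ := hb
  have hr : r ≠ 0 := by rintro rfl; simp at ha0
  have hq : (q : ℝ) ≠ 0 := by intro h; simp [h] at hb0
  have hpq : (0 : ℝ) < ((p / q : ℚ) : ℝ) := by
    have := div_pos ha0 hb0
    rw [mul_div_mul_right _ _ hr] at this
    exact_mod_cast this
  have hpos : 0 < p / q := by exact_mod_cast hpq
  refine ⟨(p / q).den, (p / q).num.toNat, (p / q).den_pos, ?_, ?_⟩
  · have := Rat.num_pos.2 hpos
    omega
  · have h1 : (((p / q).num.toNat : ℕ) : ℝ) = ((p / q).num : ℝ) := by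
      have := Int.toNat_of_nonneg (Rat.num_pos.2 hpos).le
      exact_mod_cast this
    have h2 : (((p / q : ℚ)) : ℝ) * ((p / q).den : ℝ) = ((p / q).num : ℝ) := by
      exact_mod_cast Rat.mul_den_eq_num (p / q)
    rw [h1, ← h2]
    push_cast
    field_simp

theorem exists_common_nat_mul {r a b c : ℝ} (ha : a ∈ ratMultiples r) (hb : b ∈ ratMultiples r)
    (hc : c ∈ ratMultiples r) (ha0 : 0 < a) (hb0 : 0 < b) (hc0 : 0 < c) :
    ∃ R : ℝ, ∃ k m n : ℕ, 0 < k ∧ 0 < m ∧ 0 < n ∧ (k : ℝ) * a = R ∧ m * b = R ∧ n * c = R := by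
  obtain ⟨m, n, hm, hn, h⟩ := exists_nat_mul_eq ha hb ha0 hb0
  obtain ⟨k, l, hk, hl, h'⟩ := exists_nat_mul_eq ha hc ha0 hc0
  refine ⟨m * k * a, m * k, n * k, m * l, by positivity, by positivity, by positivity,
    by push_cast; ring, ?_, ?_⟩
  · push_cast; linear_combination (-(k : ℝ)) * h
  · push_cast; linear_combination (-(m : ℝ)) * h'

end RatMultiples

/-! ### Two-point spheres and reflections -/

variable {X : Type*} [MetricSpace X]

theorem dist_mem_distSet (x y : X) : dist x y ∈ distSet X := ⟨x, y, rfl⟩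

theorem distSet_nonneg {t : ℝ} (ht : t ∈ distSet X) : 0 ≤ t := by
  obtain ⟨x, y, rfl⟩ := ht
  exact dist_nonneg

namespace IsBanakh

theorem exists_dist_eq (hX : IsBanakh X) (x : X) {t : ℝ} (ht : t ∈ distSet X) :
    ∃ u v : X, dist x u = t ∧ dist x v = t ∧ dist u v = 2 * t := by
  obtain ⟨u, v, h, h'⟩ := hX x t ht
  have hu : u ∈ Metric.sphere x t := by rw [h]; simp
  have hv : v ∈ Metric.sphere x t := by rw [h]; simp
  exact ⟨u, v, by rwa [dist_comm], by rwa [dist_comm], h'⟩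

theorem dist_eq_two_mul (hX : IsBanakh X) {c a b : X} (h : dist c a = dist c b) (hab : a ≠ b) :
    dist a b = 2 * dist c a := by
  obtain ⟨u, v, hs, h'⟩ := hX c _ (dist_mem_distSet c a)
  have ha : a ∈ Metric.sphere c (dist c a) := by simp [dist_comm]
  have hb : b ∈ Metric.sphere c (dist c a) := by simp [dist_comm, h]
  rw [hs] at ha hb
  rcases ha with rfl | rfl <;> rcases hb with rfl | rfl
  · exact absurd rfl hab
  · exact h'
  · rw [dist_comm]; exact h'
  · exact absurd rfl hab

theorem eq_of_ne_of_ne (hX : IsBanakh X) {c a b e : X} (hb : dist c a = dist c b)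
    (he : dist c a = dist c e) (hab : a ≠ b) (hae : a ≠ e) : b = e := by
  obtain ⟨u, v, hs, -⟩ := hX c _ (dist_mem_distSet c a)
  have ha' : a ∈ Metric.sphere c (dist c a) := by simp [dist_comm]
  have hb' : b ∈ Metric.sphere c (dist c a) := by simp [dist_comm, hb]
  have he' : e ∈ Metric.sphere c (dist c a) := by simp [dist_comm, he]
  rw [hs] at ha' hb' he'
  simp only [Set.mem_insert_iff, Set.mem_singleton_iff] at ha' hb' he'
  grind

/-- The point reflection of `x` in `y` exists. -/
theorem exists_reflection (hX : IsBanakh X) (y x : X) :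
    ∃ z, dist y z = dist y x ∧ dist x z = 2 * dist y x := by
  obtain ⟨u, v, hu, hv, huv⟩ := hX.exists_dist_eq y (dist_mem_distSet y x)
  by_cases h : x = u
  · subst h; exact ⟨v, hv, huv⟩
  · exact ⟨u, hu, hX.dist_eq_two_mul hu.symm h⟩

/-! ### Isometric copies of ℤ -/

/-- Each new point is the reflection of the last but one in the last. Reflection in a fixed point is
an involution, so the step on consecutive pairs is a permutation, and its integer powers extend the
chain in both directions. -/
theorem exists_chain (hX : IsBanakh X) (x y : X) :
    ∃ c : ℤ → X, c 0 = x ∧ c 1 = y ∧ (∀ n, dist (c n) (c (n + 1)) = dist x y) ∧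
      ∀ n, dist (c n) (c (n + 2)) = 2 * dist x y := by
  choose f hf hf' using hX.exists_reflection
  have hff : ∀ y x, f y (f y x) = x := by
    intro y x
    by_cases h : x = y
    · subst h
      have h1 : f x x = x := by
        have := hf x x
        rw [dist_self, dist_eq_zero] at this
        exact this.symm
      rw [h1, h1]
    · have h0 : 0 < dist y x := dist_pos.2 (Ne.symm h)
      have h1 : f y x ≠ x := by
        intro he
        have := hf' y x
        rw [he, dist_self] at this
        linarith
      have h2 : f y x ≠ f y (f y x) := by
        intro he
        have := hf' y (f y x)
        rw [← he, dist_self, hf] at this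
        linarith
      exact hX.eq_of_ne_of_ne (c := y) (a := f y x) (hf y _).symm (hf y x) h2 h1
  let T : Equiv.Perm (X × X) :=
    { toFun := fun p => (p.2, f p.2 p.1)
      invFun := fun p => (f p.1 p.2, p.1)
      left_inv := fun p => by simp [hff]
      right_inv := fun p => by simp [hff] }
  have hT : ∀ (n : ℤ) (p : X × X), (T ^ (n + 1)) p = T ((T ^ n) p) := by
    intro n p
    rw [add_comm, zpow_add, zpow_one, Equiv.Perm.mul_apply]
  have hc1 : ∀ n : ℤ, ((T ^ (n + 1)) (x, y)).1 = ((T ^ n) (x, y)).2 := by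
    intro n; rw [hT]; rfl
  have hc2 : ∀ n : ℤ, ((T ^ (n + 1)) (x, y)).2 =
      f ((T ^ n) (x, y)).2 ((T ^ n) (x, y)).1 := by
    intro n; rw [hT]; rfl
  have hd : ∀ n : ℤ, dist ((T ^ n) (x, y)).1 ((T ^ n) (x, y)).2 = dist x y := by
    have key : ∀ n : ℤ, dist ((T ^ (n + 1)) (x, y)).1 ((T ^ (n + 1)) (x, y)).2 =
        dist ((T ^ n) (x, y)).1 ((T ^ n) (x, y)).2 := by
      intro n
      rw [hc1, hc2, hf, dist_comm]
    intro n
    induction n using Int.induction_on with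
    | zero => simp
    | succ k ih => rw [key, ih]
    | pred k ih =>
      rw [← ih, ← key (-(k : ℤ) - 1)]
      simp
  refine ⟨fun n => ((T ^ n) (x, y)).1, by simp, ?_, ?_, ?_⟩
  · simp [T]
  · intro n
    simp only [hc1, hd]
  · intro n
    have : n + 2 = (n + 1) + 1 := by ring
    simp only [this, hc1, hc2, hf']
    rw [dist_comm, hd]

/-- Both ends lie at distance 2r from the midpoint, so they are 4r apart unless the chain closes
into a 4-cycle. In that case, reflect `c n` in `c (n + 2)` to get `z`. The triangle inequality puts
both remaining vertices at distance 3r from `z`, so they would be 6r apart instead of 2r. -/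
theorem chain_dist_four (hX : IsBanakh X) {c : ℤ → X} {r : ℝ} (hr : 0 < r)
    (h1 : ∀ n, dist (c n) (c (n + 1)) = r) (h2 : ∀ n, dist (c n) (c (n + 2)) = 2 * r) (n : ℤ) :
    dist (c n) (c (n + 4)) = 4 * r := by
  have e1 := h1 n
  have e2 := h1 (n + 1)
  have e3 := h1 (n + 2)
  have e4 := h1 (n + 3)
  have f1 := h2 n
  have f2 := h2 (n + 1)
  have f3 := h2 (n + 2)
  rw [show n + 1 + 1 = n + 2 by ring] at e2
  rw [show n + 2 + 1 = n + 3 by ring] at e3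
  rw [show n + 3 + 1 = n + 4 by ring] at e4
  rw [show n + 1 + 2 = n + 3 by ring] at f2
  rw [show n + 2 + 2 = n + 4 by ring] at f3
  by_cases h : c n = c (n + 4)
  · exfalso
    rw [← h] at e4
    obtain ⟨z, hz, hz'⟩ := hX.exists_reflection (c (n + 2)) (c n)
    rw [dist_comm _ (c n), f1] at hz hz'
    have g1 : dist z (c (n + 1)) = 3 * r := by
      apply le_antisymm
      · have := dist_triangle z (c (n + 2)) (c (n + 1))
        rw [dist_comm z (c (n + 2)), hz, dist_comm (c (n + 2)) (c (n + 1)), e2] at this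
        linarith
      · have := dist_triangle (c n) (c (n + 1)) z
        rw [dist_comm (c (n + 1)) z] at this
        linarith
    have g3 : dist z (c (n + 3)) = 3 * r := by
      apply le_antisymm
      · have := dist_triangle z (c (n + 2)) (c (n + 3))
        rw [dist_comm z (c (n + 2)), hz, e3] at this
        linarith
      · have := dist_triangle (c n) (c (n + 3)) z
        rw [dist_comm (c (n + 3)) z, dist_comm (c n) (c (n + 3))] at this
        linarith
    have hne : c (n + 1) ≠ c (n + 3) := by
      rw [← dist_pos, f2]; linarith
    have := hX.dist_eq_two_mul (g1.trans g3.symm) hne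
    linarith
  · have := hX.dist_eq_two_mul (c := c (n + 2)) (by rw [dist_comm, f1, f3]) h
    rw [this, dist_comm, f1]
    ring

/-- By `chain_dist_four`, every second point of a chain again forms a chain, with step 2r, so the
length can be doubled repeatedly. -/
theorem chain_dist_two_pow (hX : IsBanakh X) (k : ℕ) : ∀ {c : ℤ → X} {r : ℝ}, 0 < r →
    (∀ n, dist (c n) (c (n + 1)) = r) → (∀ n, dist (c n) (c (n + 2)) = 2 * r) → ∀ n : ℤ,
    dist (c n) (c (n + 2 ^ k)) = 2 ^ k * r := by
  induction k with
  | zero => intro c r _ h1 _ n; simpa using h1 n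
  | succ k ih =>
    intro c r hr h1 h2 n
    have := ih (c := fun m => c (n + 2 * m)) (r := 2 * r) (by linarith)
      (fun m => by
        rw [← h2 (n + 2 * m)]
        congr 2; ring)
      (fun m => by
        rw [show 2 * (2 * r) = 4 * r by ring, ← hX.chain_dist_four hr h1 h2 (n + 2 * m)]
        congr 2; ring) 0
    simp only [mul_zero, add_zero, zero_add] at this
    rw [pow_succ', this, pow_succ']
    ring

/-- Any two distinct points lie on a scaled isometric copy of the integers. -/
theorem exists_line (hX : IsBanakh X) {x y : X} (hxy : x ≠ y) :
    ∃ c : ℤ → X, c 0 = x ∧ c 1 = y ∧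
      ∀ m n : ℤ, dist (c m) (c n) = |(m : ℝ) - n| * dist x y := by
  obtain ⟨c, h0, h1, hs, hs2⟩ := hX.exists_chain x y
  refine ⟨c, h0, h1, ?_⟩
  have hr : 0 < dist x y := dist_pos.2 hxy
  set r := dist x y
  have hle : ∀ (n : ℤ) (k : ℕ), dist (c n) (c (n + k)) ≤ k * r := by
    intro n k
    induction k with
    | zero => simp
    | succ k ih =>
      have h := dist_triangle (c n) (c (n + k)) (c (n + k + 1))
      rw [hs] at h
      push_cast
      rw [← add_assoc]
      linarith
  have heq : ∀ (n : ℤ) (k : ℕ), dist (c n) (c (n + k)) = k * r := by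
    intro n k
    apply le_antisymm (hle n k)
    -- The path of 2 ^ k steps has full length and the remaining 2 ^ k - k steps contribute at most
    -- their number times r, so the first k steps must also have full length.
    have h := dist_triangle (c n) (c (n + k)) (c (n + 2 ^ k))
    rw [hX.chain_dist_two_pow k hr hs hs2] at h
    have hk : k ≤ 2 ^ k := Nat.lt_two_pow_self.le
    have h' := hle (n + k) (2 ^ k - k)
    have e : n + k + ((2 ^ k - k : ℕ) : ℤ) = n + 2 ^ k := by
      push_cast [hk]; ring
    rw [e] at h'
    push_cast [hk] at h'
    linarith
  have hmn : ∀ m n : ℤ, m ≤ n → dist (c m) (c n) = |(m : ℝ) - n| * r := by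
    intro m n h
    obtain ⟨k, rfl⟩ := Int.le.dest h
    rw [heq]
    push_cast
    rw [show (m : ℝ) - (m + k) = -k by ring, abs_neg, Nat.abs_cast]
  intro m n
  rcases le_total m n with h | h
  · exact hmn m n h
  · rw [dist_comm, hmn n m h, abs_sub_comm]

theorem exists_far_point (hX : IsBanakh X) {x y : X} (hxy : x ≠ y) {n : ℕ} (hn : 0 < n) :
    ∃ p, dist x p = n * dist x y ∧ dist y p = n * dist x y - dist x y := by
  obtain ⟨c, rfl, rfl, hc⟩ := hX.exists_line hxy
  have hn' : (1 : ℝ) ≤ n := by exact_mod_cast hn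
  refine ⟨c n, ?_, ?_⟩
  · rw [hc]; simp
  · rw [hc 1 n]
    push_cast
    rw [abs_sub_comm, abs_of_nonneg (by linarith)]
    ring

/-! ### Sides of a point and signed distance -/

/-- Points `y, z` lie on opposite sides of `x` if and only if the far points, at a common distance
from `x`, on the rays from `x` through `y` and `z` are distinct. -/
theorem dist_eq_add_iff (hX : IsBanakh X) {x y z p q : X} {R : ℝ} (hy : x ≠ y) (hz : x ≠ z)
    {n : ℕ} (hn : 0 < n) (hR : n * dist x z = R)
    (hp : dist x p = R) (hyp : dist y p = R - dist x y)
    (hq : dist x q = R) (hzq : dist z q = R - dist x z) :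
    dist y z = dist x y + dist x z ↔ p ≠ q := by
  have hy0 := dist_pos.2 hy
  have hz0 := dist_pos.2 hz
  -- The path p, y, z, q has length at least 2R, while its outer legs use only 2R minus the two
  -- radii.
  have far : ∀ z q : X, dist z q = R - dist x z → dist p q = 2 * R →
      dist y z = dist x y + dist x z := by
    intro z q hzq hpq
    apply le_antisymm
    · have := dist_triangle y x z
      rwa [dist_comm y x] at this
    · have h1 := dist_triangle4 p y z q
      rw [dist_comm p y] at h1
      linarith
  constructor
  · rintro hyz rfl
    -- Continue the line through x and z past x. Its far point there differs from p, so y is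
    -- opposite to c (-1) as well as to z. Thus y is equidistant from these two points, which would
    -- force them further apart than 2 * dist x z.
    obtain ⟨c, hc0, hc1, hc⟩ := hX.exists_line hz
    have hn' : (1 : ℝ) ≤ n := by exact_mod_cast hn
    have d1 : dist x (c (-1)) = dist x z := by
      rw [← hc0, hc, hc0]; norm_num
    have d2 : dist z (c (-1)) = 2 * dist x z := by
      conv_lhs => rw [← hc1]
      rw [hc]; norm_num
    have d3 : dist (c (-1)) (c (-n)) = R - dist x z := by
      rw [hc, ← hR]
      push_cast
      rw [abs_of_nonneg (by linarith)]
      ring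
    have d5 : dist x (c (-n)) = R := by
      rw [← hR]
      conv_lhs => rw [← hc0]
      rw [hc]; simp
    have d7 : dist z (c (-n)) = R + dist x z := by
      conv_lhs => rw [← hc1]
      rw [hc, ← hR]
      push_cast
      rw [abs_of_nonneg (by linarith)]
      ring
    have hne : p ≠ c (-n) := by
      rintro rfl
      linarith
    have hpc : dist p (c (-n)) = 2 * R := by
      rw [hX.dist_eq_two_mul (hp.trans d5.symm) hne, hp]
    have hopp := far (c (-1)) (c (-n)) (by rw [d3, d1]) hpc
    rw [d1] at hopp
    have hne' : z ≠ c (-1) := by rw [← dist_pos, d2]; linarith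
    have := hX.dist_eq_two_mul (hyz.trans hopp.symm) hne'
    linarith
  · intro hpq
    exact far z q hzq (by rw [hX.dist_eq_two_mul (hp.trans hq.symm) hpq, hp])

end IsBanakh

/-- A coordinate on `S(x; ℚr)`: a bijection onto a symmetric set of reals which measures the
distance to `x` and the distance between points on different sides of `x`. -/
structure IsCoord (x : X) (r : ℝ) (φ : X → ℝ) : Prop where
  abs_eq : ∀ y ∈ setSphere x (ratMultiples r), |φ y| = dist x y
  surj : ∀ t : ℝ, |t| ∈ distSet X ∩ ratMultiples r →
    ∃ y ∈ setSphere x (ratMultiples r), φ y = t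
  inj : ∀ y ∈ setSphere x (ratMultiples r), ∀ z ∈ setSphere x (ratMultiples r),
    φ y = φ z → y = z
  opp : ∀ y ∈ setSphere x (ratMultiples r), ∀ z ∈ setSphere x (ratMultiples r),
    φ y * φ z ≤ 0 → dist y z = dist x y + dist x z

theorem mem_setSphere_comm {x y : X} {D : Set ℝ} : y ∈ setSphere x D ↔ x ∈ setSphere y D := by
  simp [setSphere, dist_comm]

theorem self_mem_setSphere (x : X) (r : ℝ) : x ∈ setSphere x (ratMultiples r) := by
  simpa [setSphere] using ratMultiples_zero_mem r

namespace IsBanakh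

/-- Fix a reference point `e` at distance r and give the minus sign to the points opposite to it.
Opposition of y and z is the exclusive or of their oppositions to `e`: all three are inequalities
between far points on one two-point sphere. -/
theorem exists_coord (hX : IsBanakh X) (x : X) {r : ℝ} (hrD : r ∈ distSet X) (hr : 0 < r) :
    ∃ φ : X → ℝ, IsCoord x r φ := by
  obtain ⟨e, -, he, -, -⟩ := hX.exists_dist_eq x hrD
  have hxe : x ≠ e := by rw [← dist_pos, he]; exact hr
  -- among three points, being on opposite sides is governed by a two-valued invariant
  have key : ∀ y z : X, y ∈ setSphere x (ratMultiples r) → z ∈ setSphere x (ratMultiples r) →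
      x ≠ y → x ≠ z → (dist y z = dist x y + dist x z ↔
        ¬ (dist y e = dist x y + r ↔ dist z e = dist x z + r)) := by
    intro y z hy hz hxy hxz
    obtain ⟨R, k, m, n, hk, hm, hn, h1, h2, h3⟩ := exists_common_nat_mul hy hz
      (ratMultiples_self r) (dist_pos.2 hxy) (dist_pos.2 hxz) hr
    rw [← he] at h3
    obtain ⟨p, hp, hp'⟩ := hX.exists_far_point hxy hk
    obtain ⟨q, hq, hq'⟩ := hX.exists_far_point hxz hm
    obtain ⟨w, hw, hw'⟩ := hX.exists_far_point hxe hn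
    rw [h1] at hp hp'
    rw [h2] at hq hq'
    rw [h3] at hw hw'
    have A := hX.dist_eq_add_iff hxy hxz hm h2 hp hp' hq hq'
    have B := hX.dist_eq_add_iff hxy hxe hn h3 hp hp' hw hw'
    have C := hX.dist_eq_add_iff hxz hxe hn h3 hq hq' hw hw'
    rw [he] at B C
    rw [A, B, C]
    constructor
    · intro h h'
      by_cases hpw : p = w
      · subst hpw
        exact (h'.2 h.symm) rfl
      · have hqw : q ≠ w := h'.1 hpw
        exact h (hX.eq_of_ne_of_ne (hw.trans hp.symm) (hw.trans hq.symm) (Ne.symm hpw)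
          hqw.symm)
    · rintro h rfl
      exact h Iff.rfl
  classical
  let φ : X → ℝ := fun y => if dist y e = dist x y + r then - dist x y else dist x y
  have habs : ∀ y, |φ y| = dist x y := by
    intro y
    simp only [φ]
    split_ifs <;> simp
  have hzero : ∀ y, φ y = 0 → x = y := by
    intro y hy
    rw [← dist_eq_zero, ← habs, hy, abs_zero]
  have hneg : ∀ y, φ y < 0 → dist y e = dist x y + r := by
    intro y hy
    by_contra h
    simp only [φ, h, if_false] at hy
    exact absurd hy (not_lt.2 dist_nonneg)
  have hpos : ∀ y, 0 < φ y → dist y e ≠ dist x y + r := by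
    intro y hy h
    simp only [φ, h, if_true] at hy
    linarith [dist_nonneg (x := x) (y := y)]
  have hopp : ∀ y ∈ setSphere x (ratMultiples r), ∀ z ∈ setSphere x (ratMultiples r),
      φ y * φ z ≤ 0 → dist y z = dist x y + dist x z := by
    intro y hy z hz h
    rcases eq_or_ne (φ y) 0 with h0 | hy0
    · rw [← hzero y h0]; simp
    rcases eq_or_ne (φ z) 0 with h0 | hz0
    · rw [← hzero z h0]; simp [dist_comm]
    have hxy : x ≠ y := by
      rintro rfl
      exact hy0 (by rw [← abs_eq_zero, habs, dist_self])
    have hxz : x ≠ z := by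
      rintro rfl
      exact hz0 (by rw [← abs_eq_zero, habs, dist_self])
    rw [key y z hy hz hxy hxz]
    rcases lt_or_gt_of_ne hy0 with h1 | h1 <;> rcases lt_or_gt_of_ne hz0 with h2 | h2
    · nlinarith
    · exact fun h' => hpos z h2 (h'.1 (hneg y h1))
    · exact fun h' => hpos y h1 (h'.2 (hneg z h2))
    · nlinarith
  refine ⟨φ, fun y _ => habs y, ?_, ?_, hopp⟩
  · intro t ⟨htD, htQ⟩
    obtain ⟨u, v, hu, hv, huv⟩ := hX.exists_dist_eq x htD
    have hu' : u ∈ setSphere x (ratMultiples r) := by simpa [setSphere, hu] using htQ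
    have hv' : v ∈ setSphere x (ratMultiples r) := by simpa [setSphere, hv] using htQ
    rcases eq_or_ne t 0 with rfl | ht0
    · exact ⟨x, self_mem_setSphere x r, by rw [← abs_eq_zero, habs, dist_self]⟩
    have htp := abs_pos.2 ht0
    have hxu : x ≠ u := by rw [← dist_pos, hu]; exact htp
    have hxv : x ≠ v := by rw [← dist_pos, hv]; exact htp
    -- The two points at distance |t| are 2|t| apart, hence on opposite sides. Their coordinates are
    -- distinct and each is ±t, so one of them is t.
    have hk := (key u v hu' hv' hxu hxv).1 (by rw [hu, hv, huv]; ring)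
    have hφ : φ u ≠ φ v := by
      intro h
      apply hk
      have hne : φ u ≠ 0 := fun h0 => hxu (hzero u h0)
      rcases lt_or_gt_of_ne hne with h1 | h1
      · exact ⟨fun _ => hneg v (h ▸ h1), fun _ => hneg u h1⟩
      · exact ⟨fun h' => absurd h' (hpos u h1), fun h' => absurd h' (hpos v (h ▸ h1))⟩
    have hu2 := (habs u).trans hu
    have hv2 := (habs v).trans hv
    rw [abs_eq_abs] at hu2 hv2
    rcases hu2 with h1 | h1
    · exact ⟨u, hu', h1⟩
    rcases hv2 with h2 | h2
    · exact ⟨v, hv', h2⟩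
    exact absurd (h1.trans h2.symm) hφ
  · intro y hy z hz h
    by_contra hyz
    have hd : dist x y = dist x z := by rw [← habs, ← habs, h]
    have h2 := hX.dist_eq_two_mul hd hyz
    have hxy : x ≠ y := by
      rintro rfl
      rw [dist_self] at hd
      exact hyz (dist_eq_zero.1 hd.symm)
    have hxz : x ≠ z := by
      rintro rfl
      rw [dist_self] at hd
      exact hyz (dist_eq_zero.1 hd).symm
    -- Two distinct points of one sphere around x are opposite, contradicting equal signs.
    refine (key y z hy hz hxy hxz).1 (by rw [h2, ← hd]; ring) ?_
    have hne : φ y ≠ 0 := fun h0 => hxy (hzero y h0)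
    rcases lt_or_gt_of_ne hne with h1 | h1
    · exact ⟨fun _ => hneg z (h ▸ h1), fun _ => hneg y h1⟩
    · exact ⟨fun h' => absurd h' (hpos y h1), fun h' => absurd h' (hpos z (h ▸ h1))⟩

theorem add_mem (hX : IsBanakh X) {r s t : ℝ} (hr : 0 < r) (hrD : r ∈ distSet X)
    (hs : s ∈ distSet X ∩ ratMultiples r) (ht : t ∈ distSet X ∩ ratMultiples r) :
    s + t ∈ distSet X ∩ ratMultiples r := by
  refine ⟨?_, ratMultiples_add hs.2 ht.2⟩
  obtain ⟨x, -, -⟩ := id hrD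
  obtain ⟨φ, hφ⟩ := hX.exists_coord x hrD hr
  have hs0 := distSet_nonneg hs.1
  have ht0 := distSet_nonneg ht.1
  obtain ⟨y, hy, hys⟩ := hφ.surj s (by rwa [abs_of_nonneg hs0])
  obtain ⟨z, hz, hzt⟩ := hφ.surj (-t) (by rwa [abs_neg, abs_of_nonneg ht0])
  have h := hφ.opp y hy z hz (by rw [hys, hzt]; nlinarith)
  rw [← hφ.abs_eq y hy, ← hφ.abs_eq z hz, hys, hzt, abs_neg, abs_of_nonneg hs0,
    abs_of_nonneg ht0] at h
  exact ⟨y, z, h⟩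

/-! ### Points on one side -/

/-- Points on the same side of `x` are at distance less than the sum of their distances to `x`. -/
theorem dist_ne_add (hX : IsBanakh X) {x : X} {r : ℝ} {φ : X → ℝ} (hφ : IsCoord x r φ) {y z : X}
    (hy : y ∈ setSphere x (ratMultiples r)) (hz : z ∈ setSphere x (ratMultiples r))
    (h : 0 < φ y * φ z) : dist y z ≠ dist x y + dist x z := by
  intro hyz
  have ay := hφ.abs_eq y hy
  have az := hφ.abs_eq z hz
  obtain ⟨z', hz', hzz⟩ := hφ.surj (-φ z) (by
    rw [abs_neg, az]; exact ⟨dist_mem_distSet x z, hz⟩)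
  have az' := hφ.abs_eq z' hz'
  rw [hzz, abs_neg, az] at az'
  have d1 := hφ.opp y hy z' hz' (by rw [hzz]; linarith)
  have d2 := hφ.opp z hz z' hz' (by rw [hzz]; nlinarith [mul_self_nonneg (φ z)])
  have hy0 : φ y ≠ 0 := by rintro h0; simp [h0] at h
  have hz0 : φ z ≠ 0 := by rintro h0; simp [h0] at h
  have hyp : 0 < dist x y := by rw [← ay]; exact abs_pos.2 hy0
  have hzp : 0 < dist x z := by rw [← az]; exact abs_pos.2 hz0
  -- With z' the mirror image of z across x, the point y would be equidistant from z and z', forcing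
  -- dist z z' to exceed its value 2 * dist x z.
  have hne : z ≠ z' := by rw [← dist_pos]; linarith
  have := hX.dist_eq_two_mul (c := y) (a := z) (b := z') (by rw [hyz, d1, az']) hne
  linarith

theorem mul_nonpos_iff_dist (hX : IsBanakh X) {x : X} {r : ℝ} {φ : X → ℝ} (hφ : IsCoord x r φ)
    {y z : X} (hy : y ∈ setSphere x (ratMultiples r)) (hz : z ∈ setSphere x (ratMultiples r)) :
    φ y * φ z ≤ 0 ↔ dist y z = dist x y + dist x z :=
  ⟨hφ.opp y hy z hz, fun h => not_lt.1 fun h' => hX.dist_ne_add hφ hy hz h' h⟩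

/-- The point at given distance `t` from `x` on the opposite side from `y`. -/
theorem exists_opposite (hX : IsBanakh X) {x y : X} {r t : ℝ} (hr : 0 < r) (hrD : r ∈ distSet X)
    (hy : y ∈ setSphere x (ratMultiples r)) (ht : t ∈ distSet X ∩ ratMultiples r) :
    ∃ p, dist x p = t ∧ dist y p = dist x y + t := by
  obtain ⟨φ, hφ⟩ := hX.exists_coord x hrD hr
  have ht0 := distSet_nonneg ht.1
  rcases le_total 0 (φ y) with h | h
  · obtain ⟨p, hp, hpt⟩ := hφ.surj (-t) (by rwa [abs_neg, abs_of_nonneg ht0])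
    have hd : dist x p = t := by rw [← hφ.abs_eq p hp, hpt, abs_neg, abs_of_nonneg ht0]
    exact ⟨p, hd, by rw [hφ.opp y hy p hp (by rw [hpt]; nlinarith), hd]⟩
  · obtain ⟨p, hp, hpt⟩ := hφ.surj t (by rwa [abs_of_nonneg ht0])
    have hd : dist x p = t := by rw [← hφ.abs_eq p hp, hpt, abs_of_nonneg ht0]
    exact ⟨p, hd, by rw [hφ.opp y hy p hp (by rw [hpt]; nlinarith), hd]⟩

theorem eq_of_mul_pos {x : X} {r : ℝ} {φ : X → ℝ} (hφ : IsCoord x r φ)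
    {y z : X} (hy : y ∈ setSphere x (ratMultiples r)) (hz : z ∈ setSphere x (ratMultiples r))
    (h : 0 < φ y * φ z) (hd : dist x y = dist x z) : y = z := by
  apply hφ.inj y hy z hz
  rw [← hφ.abs_eq y hy, ← hφ.abs_eq z hz, abs_eq_abs] at hd
  rcases hd with hd | hd
  · exact hd
  · rw [hd] at h
    nlinarith [mul_self_nonneg (φ z)]

/-- If points `y, z` on the same side of `x` are at a commensurable distance from each other, then
this distance is the difference of their distances to `x`. -/
theorem dist_eq_sub (hX : IsBanakh X) {x y z : X} {r : ℝ} (hr : 0 < r) (hrD : r ∈ distSet X)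
    (hy : y ∈ setSphere x (ratMultiples r)) (hz : z ∈ setSphere x (ratMultiples r))
    (hyz : dist y z ∈ ratMultiples r) (hlt : dist x z < dist x y) (hxz : x ≠ z)
    (hne : dist y z ≠ dist x y + dist x z) : dist y z = dist x y - dist x z := by
  have hz0 := dist_pos.2 hxz
  -- Prolong the segment from x to y by dist x z, and the one from x to z by dist x y. Both
  -- prolongations reach the radius dist x y + dist x z on the same side of x, so they end at one
  -- point.
  obtain ⟨p, hp, hxp⟩ := hX.exists_opposite hr hrD (mem_setSphere_comm.1 hy)
    ⟨dist_mem_distSet x z, hz⟩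
  obtain ⟨q, hq, hxq⟩ := hX.exists_opposite hr hrD (mem_setSphere_comm.1 hz)
    ⟨dist_mem_distSet x y, hy⟩
  rw [dist_comm y x] at hxp
  rw [dist_comm z x, add_comm] at hxq
  have hpS : p ∈ setSphere x (ratMultiples r) := by
    simp only [setSphere, Set.mem_ofPred_eq, hxp]; exact ratMultiples_add hy hz
  have hqS : q ∈ setSphere x (ratMultiples r) := by
    simp only [setSphere, Set.mem_ofPred_eq, hxq]; exact ratMultiples_add hy hz
  obtain ⟨φ, hφ⟩ := hX.exists_coord x hrD hr
  have s1 : 0 < φ y * φ z := by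
    rw [← not_le, hX.mul_nonpos_iff_dist hφ hy hz]; exact hne
  have s2 : 0 < φ y * φ p := by
    rw [← not_le, hX.mul_nonpos_iff_dist hφ hy hpS, hp, hxp]
    intro h; linarith
  have s3 : 0 < φ z * φ q := by
    rw [← not_le, hX.mul_nonpos_iff_dist hφ hz hqS, hq, hxq]
    intro h; linarith
  have s4 : 0 < φ p * φ q := by
    have hpos : 0 < (φ y * φ z) * (φ y * φ p) * (φ z * φ q) := by positivity
    have : (φ y * φ z) * (φ y * φ p) * (φ z * φ q) = (φ y * φ z) ^ 2 * (φ p * φ q) := by ring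
    rw [this] at hpos
    exact pos_of_mul_pos_right hpos (sq_nonneg _)
  obtain rfl := eq_of_mul_pos hφ hpS hqS s4 (hxp.trans hxq.symm)
  obtain ⟨ψ, hψ⟩ := hX.exists_coord z hrD hr
  have hxZ := mem_setSphere_comm.1 hz
  have hyZ : y ∈ setSphere z (ratMultiples r) := by
    rw [mem_setSphere_comm]; exact hyz
  have hpZ : p ∈ setSphere z (ratMultiples r) := by
    simp only [setSphere, Set.mem_ofPred_eq, hq]; exact hy
  have t1 : ψ x * ψ p ≤ 0 := by
    rw [hX.mul_nonpos_iff_dist hψ hxZ hpZ, hxp, hq, dist_comm z x, add_comm]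
  -- Seen from z, the points x and p are opposite, so y is opposite to x or to p. The first case is
  -- the claim; the second gives dist x z = dist x y + dist y z, against dist x z < dist x y.
  -- Commensurability of dist y z is what places y within the domain of the coordinate at z.
  by_cases t2 : ψ y * ψ x ≤ 0
  · rw [hX.mul_nonpos_iff_dist hψ hyZ hxZ, dist_comm y x, dist_comm z y, dist_comm z x] at t2
    linarith
  · have t3 : ψ y * ψ p ≤ 0 := by
      rw [not_le] at t2
      by_contra t3
      rw [not_le] at t3
      have : 0 < (ψ y * ψ x) * (ψ y * ψ p) := by positivity
      nlinarith [mul_nonneg (sq_nonneg (ψ y)) (neg_nonneg.2 t1)]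
    rw [hX.mul_nonpos_iff_dist hψ hyZ hpZ, hp, hq] at t3
    linarith [dist_nonneg (x := z) (y := y)]

/-! ### Half-groups and signed distance -/

/-- The set of distances commensurable with `r` is a half-group as soon as it is closed under
differences. -/
theorem isHalfGroup_of_sub_mem (hX : IsBanakh X) {r : ℝ} (hr : 0 < r) (hrD : r ∈ distSet X)
    (h : ∀ s ∈ distSet X ∩ ratMultiples r, ∀ t ∈ distSet X ∩ ratMultiples r, 0 < t → t < s →
      s - t ∈ distSet X ∩ ratMultiples r) :
    IsHalfGroup (distSet X ∩ ratMultiples r) := by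
  set M := distSet X ∩ ratMultiples r with hM
  have hmem : ∀ t : ℝ, t ∈ M ∪ (-M) ↔ |t| ∈ M := by
    intro t
    simp only [Set.mem_union, Set.mem_neg]
    rcases le_total 0 t with h0 | h0
    · rw [abs_of_nonneg h0]
      refine ⟨fun h => h.elim id fun h' => ?_, Or.inl⟩
      have : t = 0 := by linarith [distSet_nonneg h'.1]
      subst this
      simpa using h'
    · rw [abs_of_nonpos h0]
      refine ⟨fun h => h.elim (fun h' => ?_) id, Or.inr⟩
      have : t = 0 := by linarith [distSet_nonneg h'.1]
      subst this
      simpa using h'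
  have h0 : (0 : ℝ) ∈ M := by
    obtain ⟨x, -, -⟩ := id hrD
    exact ⟨⟨x, x, dist_self x⟩, ratMultiples_zero_mem r⟩
  have hsub : ∀ s ∈ M, ∀ t ∈ M, |s - t| ∈ M := by
    have : ∀ s ∈ M, ∀ t ∈ M, t ≤ s → |s - t| ∈ M := by
      intro s hs t ht hle
      rw [abs_of_nonneg (by linarith)]
      rcases hle.eq_or_lt with rfl | hlt
      · simpa using h0
      rcases (distSet_nonneg ht.1).eq_or_lt with rfl | hpos
      · simpa using hs
      exact h s hs t ht hpos hlt
    intro s hs t ht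
    rcases le_total t s with hle | hle
    · exact this s hs t ht hle
    · rw [abs_sub_comm]; exact this t ht s hs hle
  refine ⟨{ carrier := M ∪ (-M), zero_mem' := ?_, add_mem' := ?_, neg_mem' := ?_ }, rfl⟩
  · intro a b ha hb
    rw [hmem] at ha hb ⊢
    rcases le_total 0 a with h1 | h1 <;> rcases le_total 0 b with h2 | h2
    · rw [abs_of_nonneg (add_nonneg h1 h2)]
      rw [abs_of_nonneg h1] at ha
      rw [abs_of_nonneg h2] at hb
      exact hX.add_mem hr hrD ha hb
    · have := hsub _ ha _ hb
      rwa [abs_of_nonneg h1, abs_of_nonpos h2, sub_neg_eq_add] at this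
    · have := hsub _ hb _ ha
      rwa [abs_of_nonneg h2, abs_of_nonpos h1, sub_neg_eq_add, add_comm] at this
    · rw [abs_of_nonpos (add_nonpos h1 h2), neg_add]
      rw [abs_of_nonpos h1] at ha
      rw [abs_of_nonpos h2] at hb
      exact hX.add_mem hr hrD ha hb
  · exact Or.inl h0
  · intro a ha
    have ha' : a ∈ M ∪ (-M) := ha
    change -a ∈ M ∪ (-M)
    rw [hmem] at ha' ⊢
    rwa [abs_neg]

theorem isHalfGroup_of_dist_mem (hX : IsBanakh X) (x : X) {r : ℝ} (hr : 0 < r)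
    (hrD : r ∈ distSet X)
    (h : ∀ y ∈ setSphere x (ratMultiples r), ∀ z ∈ setSphere x (ratMultiples r),
      dist y z ∈ ratMultiples r) :
    IsHalfGroup (distSet X ∩ ratMultiples r) := by
  obtain ⟨φ, hφ⟩ := hX.exists_coord x hrD hr
  apply hX.isHalfGroup_of_sub_mem hr hrD
  intro s hs t ht ht0 hlt
  refine ⟨?_, ratMultiples_sub hs.2 ht.2⟩
  have hs0 : 0 < s := ht0.trans hlt
  obtain ⟨y, hy, rfl⟩ := hφ.surj s (by rwa [abs_of_pos hs0])
  obtain ⟨z, hz, rfl⟩ := hφ.surj t (by rwa [abs_of_pos ht0])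
  have ay := hφ.abs_eq y hy
  have az := hφ.abs_eq z hz
  rw [abs_of_pos hs0] at ay
  rw [abs_of_pos ht0] at az
  have := hX.dist_eq_sub hr hrD hy hz (h y hy z hz) (by rwa [← ay, ← az])
    (by rw [← dist_pos, ← az]; exact ht0) (hX.dist_ne_add hφ hy hz (by positivity))
  exact ⟨y, z, by rw [this, ay, az]⟩

/-- If the distances commensurable with `r` form the half of a group, then `S(x; ℚr)` is isometric
to this group. -/
theorem exists_isometryEquiv (hX : IsBanakh X) (x : X) {r : ℝ} (hr : 0 < r)
    (hrD : r ∈ distSet X) (h : IsHalfGroup (distSet X ∩ ratMultiples r)) :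
    ∃ H : AddSubgroup ℝ, (H : Set ℝ) ⊆ ratMultiples r ∧
      Nonempty (setSphere x (ratMultiples r) ≃ᵢ H) := by
  obtain ⟨H, hH⟩ := h
  obtain ⟨φ, hφ⟩ := hX.exists_coord x hrD hr
  have hmem : ∀ t : ℝ, t ∈ H ↔ |t| ∈ distSet X ∩ ratMultiples r := by
    have hpos : ∀ t : ℝ, 0 ≤ t → (t ∈ H ↔ t ∈ distSet X ∩ ratMultiples r) := by
      intro t h0
      rw [← SetLike.mem_coe, hH, Set.mem_union, Set.mem_neg]
      refine ⟨fun h => h.elim id fun h' => ?_, Or.inl⟩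
      have : t = 0 := by linarith [distSet_nonneg h'.1]
      subst this
      simpa using h'
    intro t
    rw [← hpos _ (abs_nonneg t)]
    rcases abs_choice t with h | h <;> rw [h]
    rw [neg_mem_iff]
  have hlt : ∀ y ∈ setSphere x (ratMultiples r), ∀ z ∈ setSphere x (ratMultiples r),
      0 < φ y * φ z → dist x z ≤ dist x y → dist y z = dist x y - dist x z := by
    intro y hy z hz hpos hle
    have hz0 : φ z ≠ 0 := by intro h0; simp [h0] at hpos
    have hz1 : 0 < dist x z := by rw [← hφ.abs_eq z hz]; exact abs_pos.2 hz0
    have hm : dist x y - dist x z ∈ distSet X ∩ ratMultiples r := by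
      have h1 : dist x y ∈ H := (hmem _).2 (by
        rw [abs_of_nonneg dist_nonneg]; exact ⟨dist_mem_distSet x y, hy⟩)
      have h2 : dist x z ∈ H := (hmem _).2 (by
        rw [abs_of_nonneg dist_nonneg]; exact ⟨dist_mem_distSet x z, hz⟩)
      have h3 := (hmem _).1 (H.sub_mem h1 h2)
      rwa [abs_of_nonneg (by linarith)] at h3
    -- Starting from z, go away from x by the difference of the radii, which is a distance by the
    -- group property. The endpoint has the radius and the side of y, so it is y.
    obtain ⟨p, hp, hxp⟩ := hX.exists_opposite hr hrD (mem_setSphere_comm.1 hz) hm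
    rw [dist_comm z x, add_sub_cancel] at hxp
    have hpS : p ∈ setSphere x (ratMultiples r) := by
      simp only [setSphere, Set.mem_ofPred_eq, hxp]; exact hy
    have s1 : 0 < φ z * φ p := by
      rw [← not_le, hX.mul_nonpos_iff_dist hφ hz hpS, hp, hxp]
      intro h; linarith
    have s2 : 0 < φ y * φ p := by
      have h1 : 0 < (φ y * φ z) * (φ z * φ p) := by positivity
      have h2 : (φ y * φ z) * (φ z * φ p) = (φ z) ^ 2 * (φ y * φ p) := by ring
      rw [h2] at h1
      exact pos_of_mul_pos_right h1 (sq_nonneg _)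
    obtain rfl := eq_of_mul_pos hφ hy hpS s2 hxp.symm
    rw [dist_comm, hp]
  have hdist : ∀ y ∈ setSphere x (ratMultiples r), ∀ z ∈ setSphere x (ratMultiples r),
      dist y z = |φ y - φ z| := by
    intro y hy z hz
    have ay := hφ.abs_eq y hy
    have az := hφ.abs_eq z hz
    rcases le_or_gt (φ y * φ z) 0 with h | h
    · rw [hφ.opp y hy z hz h, ← ay, ← az]
      rcases mul_nonpos_iff.1 h with ⟨h1, h2⟩ | ⟨h1, h2⟩
      · rw [abs_of_nonneg h1, abs_of_nonpos h2, abs_of_nonneg (by linarith)]; ring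
      · rw [abs_of_nonpos h1, abs_of_nonneg h2, abs_of_nonpos (by linarith)]; ring
    · have habs : |φ y - φ z| = |dist x y - dist x z| := by
        rw [← ay, ← az]
        rcases pos_and_pos_or_neg_and_neg_of_mul_pos h with ⟨h1, h2⟩ | ⟨h1, h2⟩
        · rw [abs_of_pos h1, abs_of_pos h2]
        · rw [abs_of_neg h1, abs_of_neg h2, ← abs_neg]; congr 1; ring
      rw [habs]
      rcases le_total (dist x z) (dist x y) with hle | hle
      · rw [hlt y hy z hz h hle, abs_of_nonneg (by linarith)]
      · rw [dist_comm y z, hlt z hz y hy (by rwa [mul_comm]) hle, abs_sub_comm,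
          abs_of_nonneg (by linarith)]
  refine ⟨H, fun t ht => ratMultiples_abs_iff.1 ((hmem t).1 ht).2, ⟨?_⟩⟩
  let f : setSphere x (ratMultiples r) → H := fun y => ⟨φ y, (hmem _).2 (by
    rw [hφ.abs_eq y y.2]; exact ⟨dist_mem_distSet x y, y.2⟩)⟩
  have hf : Isometry f := Isometry.of_dist_eq fun y z => by
    rw [Subtype.dist_eq, Subtype.dist_eq, Real.dist_eq]
    exact (hdist y y.2 z z.2).symm
  have hsurj : Function.Surjective f := by
    rintro ⟨t, ht⟩
    obtain ⟨y, hy, hyt⟩ := hφ.surj t ((hmem t).1 ht)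
    exact ⟨⟨y, hy⟩, Subtype.ext hyt⟩
  exact ⟨Equiv.ofBijective f ⟨hf.injective, hsurj⟩, hf⟩

/-! ### Central symmetry -/

/-- Place y and z on one side of x at distances s and t. An isometry fixing y and moving x sends x
to a point u at distance 2s from x, and z to some w at distance t from u. Since w stays in the
sphere, dist x w is commensurable with r, so `dist_eq_sub` at u makes it |2s - t|. -/
theorem abs_two_mul_sub_mem (hX : IsBanakh X) (x : X) {r : ℝ} (hr : 0 < r)
    (hrD : r ∈ distSet X) (h : IsCentrallySymmetric (setSphere x (ratMultiples r)))
    {s t : ℝ} (hs : s ∈ distSet X ∩ ratMultiples r) (ht : t ∈ distSet X ∩ ratMultiples r) :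
    |2 * s - t| ∈ distSet X ∩ ratMultiples r := by
  rcases (distSet_nonneg hs.1).eq_or_lt with rfl | hs0
  · rw [mul_zero, zero_sub, abs_neg, abs_of_nonneg (distSet_nonneg ht.1)]; exact ht
  have h2s : 2 * s ∈ distSet X ∩ ratMultiples r := by
    rw [two_mul]; exact hX.add_mem hr hrD hs hs
  rcases (distSet_nonneg ht.1).eq_or_lt with rfl | ht0
  · rw [sub_zero, abs_of_pos (by linarith)]; exact h2s
  obtain ⟨φ, hφ⟩ := hX.exists_coord x hrD hr
  obtain ⟨y, hy, hys⟩ := hφ.surj s (by rwa [abs_of_pos hs0])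
  obtain ⟨z, hz, hzt⟩ := hφ.surj t (by rwa [abs_of_pos ht0])
  have ay := hφ.abs_eq y hy
  have az := hφ.abs_eq z hz
  rw [hys, abs_of_pos hs0] at ay
  rw [hzt, abs_of_pos ht0] at az
  have hxy : x ≠ y := by rw [← dist_pos, ← ay]; exact hs0
  have hne := hX.dist_ne_add hφ hy hz (by rw [hys, hzt]; positivity)
  obtain ⟨f, hf, hf'⟩ := h ⟨y, hy⟩ ⟨x, self_mem_setSphere x r⟩
    (fun he => hxy (congrArg Subtype.val he).symm)
  have d1 := f.isometry.dist_eq ⟨y, hy⟩ ⟨x, self_mem_setSphere x r⟩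
  have d2 := f.isometry.dist_eq ⟨y, hy⟩ ⟨z, hz⟩
  have d3 := f.isometry.dist_eq ⟨x, self_mem_setSphere x r⟩ ⟨z, hz⟩
  have hfx : ((f ⟨x, self_mem_setSphere x r⟩ : setSphere x (ratMultiples r)) : X) ≠ x :=
    fun he => hf' (Subtype.ext he)
  rw [hf] at d1 d2
  have hw := (f ⟨z, hz⟩).2
  simp only [Subtype.dist_eq] at d1 d2 d3
  generalize ((f ⟨x, self_mem_setSphere x r⟩ : setSphere x (ratMultiples r)) : X) = u at *
  generalize ((f ⟨z, hz⟩ : setSphere x (ratMultiples r)) : X) = w at *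
  have d4 := hX.dist_eq_two_mul d1 hfx
  rw [d1, dist_comm y x, ← ay] at d4
  rw [← az] at d3
  have hwx : dist x w ∈ ratMultiples r := hw
  have hxu : x ∈ setSphere u (ratMultiples r) := by
    simp only [setSphere, Set.mem_ofPred_eq, d4]; exact h2s.2
  have hwu : w ∈ setSphere u (ratMultiples r) := by
    simp only [setSphere, Set.mem_ofPred_eq, d3]; exact ht.2
  -- If x and w were opposite across u, then 2s + t = dist x w ≤ s + dist y z, which puts y and z on
  -- opposite sides of x.
  have hne' : dist x w ≠ dist u x + dist u w := by
    intro he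
    apply hne
    apply le_antisymm
    · have := dist_triangle y x z
      rwa [dist_comm y x] at this
    · have := dist_triangle x y w
      rw [d2] at this
      linarith
  have hmem : |2 * s - t| ∈ distSet X := by
    rcases lt_trichotomy t (2 * s) with hlt | heq | hlt
    · rw [abs_of_pos (by linarith)]
      have := hX.dist_eq_sub hr hrD hxu hwu hwx (by rwa [d3, d4])
        (by rw [← dist_pos, d3]; exact ht0) hne'
      exact ⟨x, w, by rw [this, d4, d3]⟩
    · rw [← heq, sub_self, abs_zero]
      exact ⟨x, x, dist_self x⟩
    · rw [abs_of_neg (by linarith)]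
      have := hX.dist_eq_sub hr hrD hwu hxu (by rwa [dist_comm]) (by rwa [d3, d4])
        (by rw [← dist_pos, d4]; linarith) (by rwa [dist_comm w x, add_comm])
      exact ⟨w, x, by rw [this, d4, d3]; ring⟩
  exact ⟨hmem, ratMultiples_abs_iff.2 (ratMultiples_sub h2s.2 ht.2)⟩

theorem isHalfGroup_of_isCentrallySymmetric (hX : IsBanakh X) (x : X) {r : ℝ} (hr : 0 < r)
    (hrD : r ∈ distSet X) (h : IsCentrallySymmetric (setSphere x (ratMultiples r))) :
    IsHalfGroup (distSet X ∩ ratMultiples r) := by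
  -- Signed version, needed because the progression below may change sign; for a and b of opposite
  -- signs, |2a - b| is a sum of distances.
  have h2 : ∀ a b : ℝ, |a| ∈ distSet X ∩ ratMultiples r → |b| ∈ distSet X ∩ ratMultiples r →
      |2 * a - b| ∈ distSet X ∩ ratMultiples r := by
    intro a b ha hb
    have hd := hX.abs_two_mul_sub_mem x hr hrD h ha hb
    have hs := hX.add_mem hr hrD (hX.add_mem hr hrD ha ha) hb
    rcases le_total 0 a with h1 | h1 <;> rcases le_total 0 b with h2 | h2
    · rwa [abs_of_nonneg h1, abs_of_nonneg h2] at hd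
    · rw [abs_of_nonneg h1, abs_of_nonpos h2] at hs
      rw [abs_of_nonneg (by linarith)]
      convert hs using 1; ring
    · rw [abs_of_nonpos h1, abs_of_nonneg h2] at hs
      rw [abs_of_nonpos (by linarith)]
      convert hs using 1; ring
    · rw [abs_of_nonpos h1, abs_of_nonpos h2] at hd
      rw [← abs_neg]
      convert hd using 2; ring
  apply hX.isHalfGroup_of_sub_mem hr hrD
  intro s hs t ht ht0 hlt
  have hδ : 0 < s - t := by linarith
  -- With q t = p (s - t), the progression a_j = q t + (1 - j)(s - t) starts with (q - 1) t + s and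
  -- q t, both sums of known distances. It satisfies a_{j+1} = 2 a_j - a_{j-1}, and a_p = s - t.
  obtain ⟨q, p, hq, hp, hpq⟩ := exists_nat_mul_eq ht.2 (ratMultiples_sub hs.2 ht.2) ht0 hδ
  have hmul : ∀ n : ℕ, (n : ℝ) * t ∈ distSet X ∩ ratMultiples r := by
    intro n
    induction n with
    | zero => simpa using ⟨⟨x, x, dist_self x⟩, ratMultiples_zero_mem r⟩
    | succ n ih =>
      have := hX.add_mem hr hrD ih ht
      convert this using 1
      push_cast; ring
  obtain ⟨m, rfl⟩ : ∃ m, q = m + 1 := ⟨q - 1, by omega⟩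
  have hrec : ∀ j : ℕ, |((m + 1 : ℕ) : ℝ) * t + (1 - j) * (s - t)| ∈
        distSet X ∩ ratMultiples r ∧
      |((m + 1 : ℕ) : ℝ) * t + (1 - (j + 1 : ℕ)) * (s - t)| ∈ distSet X ∩ ratMultiples r := by
    intro j
    induction j with
    | zero =>
      constructor
      · have e : ((m + 1 : ℕ) : ℝ) * t + (1 - (0 : ℕ)) * (s - t) = m * t + s := by
          push_cast; ring
        have hs0 := ht0.trans hlt
        rw [e, abs_of_nonneg (by positivity)]
        exact hX.add_mem hr hrD (hmul m) hs
      · have e : ((m + 1 : ℕ) : ℝ) * t + (1 - (0 + 1 : ℕ)) * (s - t) = (m + 1 : ℕ) * t := by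
          push_cast; ring
        rw [e, abs_of_nonneg (by positivity)]
        exact hmul _
    | succ j ih =>
      refine ⟨ih.2, ?_⟩
      have := h2 _ _ ih.2 ih.1
      convert this using 2
      push_cast; ring
  have := (hrec p).1
  rw [hpq] at this
  rwa [show (p : ℝ) * (s - t) + (1 - p) * (s - t) = s - t by ring, abs_of_pos hδ] at this

end IsBanakh

/-! ### The equivalences and the rational case -/

/-- Transport the reflection h ↦ 2 g(c) - h of the group; its only fixed point is g(c), since ℝ has
no 2-torsion. -/
theorem isCentrallySymmetric_of_isometryEquiv {Y : Type*} [MetricSpace Y] {H : AddSubgroup ℝ}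
    (g : Y ≃ᵢ H) : IsCentrallySymmetric Y := by
  intro c y hcy
  refine ⟨(g.trans (IsometryEquiv.subLeft (g c + g c))).trans g.symm, ?_, ?_⟩
  · simp
  · simp only [IsometryEquiv.trans_apply, IsometryEquiv.subLeft_apply, ne_eq,
      IsometryEquiv.symm_apply_eq]
    intro h
    apply hcy
    apply g.injective
    have h' := congrArg (Subtype.val : H → ℝ) h
    push_cast at h'
    exact Subtype.ext (by linarith)

/-- In ℝ, each difference of coordinates is a difference of two signed distances to the image of x,
both of which lie in ℚr. -/
theorem dist_mem_ratMultiples_of_isometryEquiv (x : X) {r : ℝ} {A : Set ℝ}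
    (g : setSphere x (ratMultiples r) ≃ᵢ A) :
    ∀ y ∈ setSphere x (ratMultiples r), ∀ z ∈ setSphere x (ratMultiples r),
      dist y z ∈ ratMultiples r := by
  intro y hy z hz
  have key : ∀ y (hy : y ∈ setSphere x (ratMultiples r)),
      ((g ⟨x, self_mem_setSphere x r⟩ : A) : ℝ) - (g ⟨y, hy⟩ : A) ∈ ratMultiples r := by
    intro y hy
    rw [← ratMultiples_abs_iff, ← Real.dist_eq, ← Subtype.dist_eq, g.dist_eq]
    exact hy
  have h := g.dist_eq ⟨y, hy⟩ ⟨z, hz⟩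
  rw [Subtype.dist_eq, Subtype.dist_eq, Real.dist_eq] at h
  rw [← h, ratMultiples_abs_iff]
  have := ratMultiples_sub (key z hz) (key y hy)
  convert this using 1
  ring

theorem subsingleton_setSphere_ratMultiples_zero (x : X) :
    Subsingleton (setSphere x (ratMultiples 0)) := by
  have h : ∀ y ∈ setSphere x (ratMultiples 0), y = x := by
    rintro y ⟨q, hq⟩
    rw [mul_zero, dist_eq_zero] at hq
    exact hq.symm
  exact ⟨fun a b => Subtype.ext ((h a a.2).trans (h b b.2).symm)⟩

/-- A one-point metric space is isometric to any other one. -/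
theorem nonempty_isometryEquiv_of_subsingleton {Y Z : Type*} [MetricSpace Y] [MetricSpace Z]
    [Subsingleton Y] [Subsingleton Z] (y : Y) (z : Z) : Nonempty (Y ≃ᵢ Z) :=
  ⟨⟨⟨fun _ => z, fun _ => y, fun _ => Subsingleton.elim _ _, fun _ => Subsingleton.elim _ _⟩,
    isometry_subsingleton⟩⟩

theorem isHalfGroup_ratMultiples_zero (x : X) : IsHalfGroup (distSet X ∩ ratMultiples 0) := by
  refine ⟨⊥, ?_⟩
  have : distSet X ∩ ratMultiples 0 = {0} := by
    ext t
    simp only [Set.mem_inter_iff, Set.mem_singleton_iff]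
    constructor
    · rintro ⟨-, q, hq⟩
      simpa using hq
    · rintro rfl
      exact ⟨⟨x, x, dist_self x⟩, ratMultiples_zero_mem 0⟩
  rw [this]
  simp

theorem IsBanakh.exists_isometryEquiv_of_isHalfGroup (hX : IsBanakh X) (x : X) {r : ℝ}
    (hrD : r ∈ distSet X) (h : IsHalfGroup (distSet X ∩ ratMultiples r)) :
    ∃ H : AddSubgroup ℝ, (H : Set ℝ) ⊆ ratMultiples r ∧
      Nonempty (setSphere x (ratMultiples r) ≃ᵢ H) := by
  rcases (distSet_nonneg hrD).eq_or_lt with rfl | hr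
  · have := subsingleton_setSphere_ratMultiples_zero x
    refine ⟨⊥, ?_, nonempty_isometryEquiv_of_subsingleton ⟨x, self_mem_setSphere x 0⟩ 0⟩
    rintro t rfl
    exact ratMultiples_zero_mem 0
  · exact hX.exists_isometryEquiv x hr hrD h

theorem IsBanakh.tfae (hX : IsBanakh X) (x : X) {r : ℝ} (hrD : r ∈ distSet X) :
    List.TFAE [
      ∃ A : Set ℝ, Nonempty (setSphere x (ratMultiples r) ≃ᵢ A),
      ∃ H : AddSubgroup ℝ, (H : Set ℝ) ⊆ ratMultiples r ∧
        Nonempty (setSphere x (ratMultiples r) ≃ᵢ H),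
      ∀ y ∈ setSphere x (ratMultiples r), ∀ z ∈ setSphere x (ratMultiples r),
        dist y z ∈ ratMultiples r,
      IsCentrallySymmetric (setSphere x (ratMultiples r)),
      IsHalfGroup (distSet X ∩ ratMultiples r)] := by
  tfae_have 2 → 1 := fun ⟨H, _, hg⟩ => ⟨H, hg⟩
  tfae_have 1 → 3 := fun ⟨_, ⟨g⟩⟩ => dist_mem_ratMultiples_of_isometryEquiv x g
  tfae_have 2 → 4 := fun ⟨_, _, ⟨g⟩⟩ => isCentrallySymmetric_of_isometryEquiv g
  tfae_have 3 → 5 := fun h => by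
    rcases (distSet_nonneg hrD).eq_or_lt with rfl | hr
    · exact isHalfGroup_ratMultiples_zero x
    · exact hX.isHalfGroup_of_dist_mem x hr hrD h
  tfae_have 4 → 5 := fun h => by
    rcases (distSet_nonneg hrD).eq_or_lt with rfl | hr
    · exact isHalfGroup_ratMultiples_zero x
    · exact hX.isHalfGroup_of_isCentrallySymmetric x hr hrD h
  tfae_have 5 → 2 := hX.exists_isometryEquiv_of_isHalfGroup x hrD
  tfae_finish

theorem IsBanakh.exists_isometryEquiv_rat (hX : IsBanakh X) (x : X)
    (hQ : distSet X ⊆ Set.range ((↑) : ℚ → ℝ)) :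
    ∃ G : AddSubgroup ℚ, Nonempty (X ≃ᵢ G) := by
  by_cases h : ∃ r ∈ distSet X, 0 < r
  · obtain ⟨r, hrD, hr⟩ := h
    obtain ⟨q, rfl⟩ := hQ hrD
    have hq0 : (q : ℝ) ≠ 0 := hr.ne'
    have hall : ∀ y z : X, dist y z ∈ ratMultiples q := by
      intro y z
      obtain ⟨p, hp⟩ := hQ (dist_mem_distSet y z)
      exact ⟨p / q, by rw [← hp]; push_cast; field_simp⟩
    -- The indices of `out` count from 0, so this is (3) ⇒ (2).
    obtain ⟨H, hH, ⟨g⟩⟩ := ((hX.tfae x hrD).out 2 1).1 (fun y _ z _ => hall y z)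
    have hH' : ∀ t ∈ H, ∃ p : ℚ, (p : ℝ) = t := by
      intro t ht
      obtain ⟨p, hp⟩ := hH ht
      exact ⟨p * q, by rw [hp]; push_cast; rfl⟩
    refine ⟨H.comap (Rat.castHom ℝ).toAddMonoidHom, ?_⟩
    choose p hp using fun y : X => hH' _ (g ⟨y, hall x y⟩).2
    let f : X → H.comap (Rat.castHom ℝ).toAddMonoidHom := fun y => ⟨p y, by
      change ((p y : ℚ) : ℝ) ∈ H
      rw [hp]
      exact (g ⟨y, hall x y⟩).2⟩
    have hf : Isometry f := Isometry.of_dist_eq fun y z => by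
      have := g.dist_eq ⟨y, hall x y⟩ ⟨z, hall x z⟩
      rw [Subtype.dist_eq, Subtype.dist_eq, ← hp, ← hp, Rat.dist_cast] at this
      exact this
    have hsurj : Function.Surjective f := by
      rintro ⟨t, ht⟩
      have ht' : (t : ℝ) ∈ H := ht
      obtain ⟨⟨y, hy⟩, hyt⟩ := g.surjective ⟨t, ht'⟩
      have h1 : ((p y : ℚ) : ℝ) = t := by rw [hp, hyt]
      exact ⟨y, Subtype.ext (Rat.cast_injective h1)⟩
    exact ⟨⟨Equiv.ofBijective f ⟨hf.injective, hsurj⟩, hf⟩⟩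
  · have : Subsingleton X := ⟨fun a b => by
      by_contra hab
      exact h ⟨_, dist_mem_distSet a b, dist_pos.2 hab⟩⟩
    exact ⟨⊥, nonempty_isometryEquiv_of_subsingleton x 0⟩

end BanakhSpace

theorem theoremt {X : Type*} [MetricSpace X] (hX : BanakhSpace.IsBanakh X) :
    (∀ x : X, ∀ r ∈ BanakhSpace.distSet X,
      List.TFAE [
        ∃ A : Set ℝ,
          Nonempty (BanakhSpace.setSphere x (BanakhSpace.ratMultiples r) ≃ᵢ A),
        ∃ H : AddSubgroup ℝ, (H : Set ℝ) ⊆ BanakhSpace.ratMultiples r ∧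
          Nonempty (BanakhSpace.setSphere x (BanakhSpace.ratMultiples r) ≃ᵢ H),
        ∀ y ∈ BanakhSpace.setSphere x (BanakhSpace.ratMultiples r),
          ∀ z ∈ BanakhSpace.setSphere x (BanakhSpace.ratMultiples r),
            dist y z ∈ BanakhSpace.ratMultiples r,
        BanakhSpace.IsCentrallySymmetric
          (BanakhSpace.setSphere x (BanakhSpace.ratMultiples r)),
        BanakhSpace.IsHalfGroup
          (BanakhSpace.distSet X ∩ BanakhSpace.ratMultiples r)]) ∧
    (Nonempty X → BanakhSpace.distSet X ⊆ Set.range ((↑) : ℚ → ℝ) →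
      ∃ G : AddSubgroup ℚ, Nonempty (X ≃ᵢ G)) := by
  exact ⟨fun x r hr => hX.tfae x hr, fun ⟨x⟩ hQ => hX.exists_isometryEquiv_rat x hQ⟩
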